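/- For a group $G$ let $\mathrm{sq}\colon G\to G$ be the square map $\mathrm{sq}(g)=g^2$, and call $G$ virtually abelian if it has an abelian subgroup of finite index. Let $G$ be a finitely generated group, let $s\in G$, let $m\ge 0$, let $H_1,\dots,H_m$ be subgroups of $G$ and let $a_1,\dots,a_m\in G$. Assume that $$G=\mathrm{sq}^{-1}(1)\cup s\,\mathrm{sq}^{-1}(1)\cup a_1H_1\cup\dots\cup a_mH_m .$$ Let $\alpha:=\sum_{i=1}^m \frac{1}{|G:H_i|}$, with the convention $\frac1\infty=0$. 1. If $\alpha<\frac{3-\sqrt5}{4}$, then either $G$ is virtually abelian, or the conjugacy class of $s^2$ is finite of cardinality less than $\frac{4}{(3-\sqrt5-4\alpha)^2}$. 2. If $s^2=1$ (in particular, if $s$ is an involution) and $\alpha<\frac{(1-\alpha)^3}{24}$, then $G$ is virtually abelian. -/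

import Mathlib

open scoped Pointwise

/-- The square map `g ↦ g ^ 2` of a group. -/
def squareMap {G : Type*} [Group G] (g : G) : G := g ^ 2

/-- A group is virtually abelian if it has an abelian subgroup of finite index. -/
def IsVirtuallyAbelian (G : Type*) [Group G] : Prop :=
  ∃ A : Subgroup G, A.FiniteIndex ∧ IsMulCommutative A

/-- The sum of the inverses of the indices of finitely many subgroups. `Subgroup.index` is `0` for
a subgroup of infinite index, so such a subgroup contributes `0⁻¹ = 0`, which is the usual
convention `1 / ∞ = 0`. -/
noncomputable def sumInvIndex {G : Type*} [Group G] {m : ℕ} (H : Fin m → Subgroup G) : ℝ :=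
  ∑ i, ((H i).index : ℝ)⁻¹

/-!
The square roots of `1` are controlled by centralizers: if `x`, `y` and `x * y` all square to `1`,
then `y` commutes with `x`; and if `y` and `s⁻¹ * x * y` square to `1`, then `y` inverts `s⁻¹ * x`
under conjugation, so that `y` lies in a prescribed left coset of the centralizer of `s⁻¹ * x`.

Write `I` for the set of square roots of `1` and `A` for the union of the given cosets, so that
`G = I ∪ s I ∪ A`. Suppose that the FC-centre `F` of `G`, the subgroup of the elements with
centralizer of finite index, has infinite index. If some `x ∈ I` lies neither in `F` nor in `s F`,
then `y ∈ I` forces `x * y` to lie in `I`, in `s I` or in `A`, so `I` is covered by `x⁻¹ A` and two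
cosets of subgroups of infinite index. Hence `G` is covered by `A`, `x⁻¹ A`, `s x⁻¹ A` and finitely
many cosets of infinite index. By the quantitative form of B. H. Neumann's lemma, the sum of the
inverse indices in such a cover is at least `1`, so `3 α ≥ 1`. If there is no such `x`, then
`I ⊆ F ∪ s F`, and the same lemma gives `α ≥ 1`.

So `α < 1 / 3` makes `F` a subgroup of finite index (`fcCenter_finiteIndex_of_cover`). It is then
finitely generated, its centre is a finite intersection of subgroups of finite index, and `G` is
virtually abelian (`isVirtuallyAbelian_of_fcCenter_finiteIndex`). The bounds on `α` in both parts of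
the theorem imply `α < 1 / 3`. In particular, in the first part the first alternative always holds.
-/

/-- `CosetCovered S c` says that `S` is contained in a union of finitely many left cosets of
subgroups whose inverse indices add up to exactly `c`. A subgroup of infinite index has
`Subgroup.index` equal to `0`, so it contributes `0⁻¹ = 0`. -/
def CosetCovered {G : Type*} [Group G] (S : Set G) (c : ℝ) : Prop :=
  ∃ (ι : Type) (_ : Fintype ι) (K : ι → Subgroup G) (b : ι → G),
    S ⊆ ⋃ i, b i • (K i : Set G) ∧ ∑ i, ((K i).index : ℝ)⁻¹ = c

namespace CosetCovered

variable {G : Type*} [Group G] {S T : Set G} {c d : ℝ}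

theorem mono (hT : CosetCovered T c) (h : S ⊆ T) : CosetCovered S c := by
  obtain ⟨ι, _, K, b, hc, hw⟩ := hT
  exact ⟨ι, inferInstance, K, b, h.trans hc, hw⟩

theorem union (hS : CosetCovered S c) (hT : CosetCovered T d) : CosetCovered (S ∪ T) (c + d) := by
  obtain ⟨ι, _, K, b, hc, hw⟩ := hS
  obtain ⟨κ, _, L, e, hc', hw'⟩ := hT
  refine ⟨ι ⊕ κ, inferInstance, Sum.elim K L, Sum.elim b e, ?_, ?_⟩
  · rw [Set.iUnion_sum]
    exact Set.union_subset_union hc hc'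
  · simp [hw, hw']

theorem smul (g : G) (hS : CosetCovered S c) : CosetCovered (g • S) c := by
  obtain ⟨ι, _, K, b, hc, hw⟩ := hS
  refine ⟨ι, inferInstance, K, fun i => g * b i, ?_, hw⟩
  refine (Set.smul_set_mono hc).trans ?_
  rw [Set.smul_set_iUnion]
  simp only [smul_smul]
  exact subset_rfl

theorem of_not_finiteIndex (g : G) {K : Subgroup G} (hK : ¬ K.FiniteIndex) :
    CosetCovered (g • (K : Set G)) 0 := by
  refine ⟨Unit, inferInstance, fun _ => K, fun _ => g, Set.subset_iUnion (fun _ : Unit => g • (K : Set G)) (), ?_⟩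
  have : K.index = 0 := by
    by_contra h
    exact hK ⟨h⟩
  simp [this]

/-- B. H. Neumann's lemma, with weights. -/
theorem one_le (h : CosetCovered (Set.univ : Set G) c) : 1 ≤ c := by
  obtain ⟨ι, _, K, b, hc, hw⟩ := h
  have h1 := Subgroup.one_le_sum_inv_index_of_leftCoset_cover (s := Finset.univ) (H := K) (g := b)
    (by simpa using Set.univ_subset_iff.1 hc)
  rw [← hw]
  have h2 : ((1 : ℚ) : ℝ) ≤ ((∑ i, ((K i).index : ℚ)⁻¹ : ℚ) : ℝ) := Rat.cast_le.2 h1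
  simpa using h2

end CosetCovered

/-- The FC-centre of a group: the subgroup of the elements whose conjugacy class is finite, encoded
as the elements whose centralizer has finite index. -/
def fcCenter (G : Type*) [Group G] : Subgroup G where
  carrier := {g | (Subgroup.centralizer {g}).FiniteIndex}
  one_mem' := by
    have : Subgroup.centralizer {(1 : G)} = ⊤ := by
      ext g
      simp [Subgroup.mem_centralizer_iff]
    rw [Set.mem_ofPred_eq, this]
    infer_instance
  mul_mem' := by
    intro x y (hx : Subgroup.FiniteIndex _) (hy : Subgroup.FiniteIndex _)
    refine Subgroup.finiteIndex_of_le
      (H := Subgroup.centralizer {x} ⊓ Subgroup.centralizer {y}) ?_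
    rintro g ⟨h1, h2⟩
    have hx := Subgroup.mem_centralizer_iff.1 h1 x rfl
    have hy := Subgroup.mem_centralizer_iff.1 h2 y rfl
    rw [Subgroup.mem_centralizer_iff]
    rintro _ rfl
    rw [mul_assoc, hy, ← mul_assoc, hx, mul_assoc]
  inv_mem' := by
    intro x (hx : Subgroup.FiniteIndex _)
    refine Subgroup.finiteIndex_of_le (H := Subgroup.centralizer {x}) ?_
    intro g h1
    simp only [Subgroup.mem_centralizer_iff, Set.mem_singleton_iff, forall_eq] at h1 ⊢
    rw [inv_mul_eq_iff_eq_mul, ← mul_assoc, h1, mul_inv_cancel_right]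

theorem mem_fcCenter {G : Type*} [Group G] {g : G} :
    g ∈ fcCenter G ↔ (Subgroup.centralizer {g}).FiniteIndex := Iff.rfl

theorem isVirtuallyAbelian_of_fcCenter_finiteIndex {G : Type*} [Group G] [Group.FG G]
    (hF : (fcCenter G).FiniteIndex) : IsVirtuallyAbelian G := by
  -- Schreier's lemma: `fcCenter G` is finitely generated.
  obtain ⟨S, hS⟩ := (Group.fg_iff_subgroup_fg (fcCenter G)).1 inferInstance
  -- The centralizer of `fcCenter G` is the centralizer of its finitely many generators.
  have hC : (Subgroup.centralizer (fcCenter G : Set G)).FiniteIndex := by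
    have hle : ⨅ g ∈ S, Subgroup.centralizer {g} ≤ Subgroup.centralizer (fcCenter G : Set G) := by
      rw [← hS, Subgroup.centralizer_closure]
      intro x hx
      simp only [Subgroup.mem_iInf, Subgroup.mem_centralizer_iff, Set.mem_singleton_iff,
        forall_eq] at hx
      exact Subgroup.mem_centralizer_iff.2 hx
    have := Subgroup.finiteIndex_iInf' (s := S) (fun g : G => Subgroup.centralizer {g})
      fun g hg => mem_fcCenter.1 (hS ▸ Subgroup.subset_closure hg)
    exact Subgroup.finiteIndex_of_le hle
  refine ⟨fcCenter G ⊓ Subgroup.centralizer (fcCenter G : Set G), inferInstance,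
    IsMulCommutative.of_comm ?_⟩
  rintro ⟨x, hx, -⟩ ⟨y, -, hy⟩
  exact Subtype.ext (Subgroup.mem_centralizer_iff.1 hy x hx)

section SquareRoots

variable {G : Type*} [Group G]

theorem mem_preimage_squareMap_one {g : G} : g ∈ squareMap ⁻¹' {(1 : G)} ↔ g * g = 1 := by
  simp [squareMap, sq]

/-- The square roots `y` of `1` such that `u * y` is also a square root of `1` invert `u` under
conjugation. -/
theorem conj_eq_inv_of_mul_self_eq_one {u y : G} (hy : y * y = 1) (huy : u * y * (u * y) = 1) :
    y * u * y⁻¹ = u⁻¹ := by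
  rw [← eq_inv_of_mul_eq_one_left hy, eq_comm, inv_eq_iff_mul_eq_one]
  simpa only [mul_assoc] using huy

/-- The elements conjugating `u` to a fixed element lie in one coset of the centralizer of `u`. -/
theorem cosetCovered_conj_eq {u : G} (hu : u ∉ fcCenter G) (v : G) :
    CosetCovered {y : G | y * u * y⁻¹ = v} 0 := by
  obtain h | ⟨z, hz⟩ := Set.eq_empty_or_nonempty {y : G | y * u * y⁻¹ = v}
  · exact (CosetCovered.of_not_finiteIndex 1 hu).mono (h ▸ Set.empty_subset _)
  · refine (CosetCovered.of_not_finiteIndex z hu).mono fun y hy => ?_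
    rw [mem_leftCoset_iff, SetLike.mem_coe, Subgroup.mem_centralizer_iff]
    intro w hw
    rw [Set.mem_singleton_iff.1 hw]
    have hy' : y * u * y⁻¹ = z * u * z⁻¹ := hy.trans hz.symm
    calc u * (z⁻¹ * y) = z⁻¹ * (z * u * z⁻¹) * y := by group
      _ = z⁻¹ * (y * u * y⁻¹) * y := by rw [hy']
      _ = z⁻¹ * y * u := by group

theorem fcCenter_finiteIndex_of_cover (s : G) {A : Set G} {α : ℝ} (hA : CosetCovered A α)
    (hcover : (Set.univ : Set G) = squareMap ⁻¹' {1} ∪ s • (squareMap ⁻¹' {1}) ∪ A)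
    (hα : α < 1 / 3) : (fcCenter G).FiniteIndex := by
  by_contra hF
  -- A cover of the square roots of `1` of weight `c` yields a cover of `G` of weight `2 * c + α`.
  have hone : ∀ c, CosetCovered (squareMap ⁻¹' {(1 : G)}) c → 1 ≤ c + c + α := fun c hc =>
    (hcover ▸ (hc.union (hc.smul s)).union hA :
      CosetCovered (Set.univ : Set G) (c + c + α)).one_le
  by_cases hx : ∃ x : G, x * x = 1 ∧ x ∉ fcCenter G ∧ s⁻¹ * x ∉ fcCenter G
  · obtain ⟨x, -, hxF, hsxF⟩ := hx
    have hI : CosetCovered (squareMap ⁻¹' {(1 : G)}) (0 + 0 + α) := by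
      refine (((cosetCovered_conj_eq hxF x⁻¹).union
        (cosetCovered_conj_eq hsxF (s⁻¹ * x)⁻¹)).union (hA.smul x⁻¹)).mono fun y hy => ?_
      rw [mem_preimage_squareMap_one] at hy
      have hxy : x * y ∈ (Set.univ : Set G) := Set.mem_univ _
      rw [hcover] at hxy
      obtain (h | h) | h := hxy
      · exact .inl (.inl (conj_eq_inv_of_mul_self_eq_one hy (mem_preimage_squareMap_one.1 h)))
      · rw [Set.mem_smul_set_iff_inv_smul_mem, mem_preimage_squareMap_one, smul_eq_mul,
          ← mul_assoc s⁻¹ x y] at h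
        exact .inl (.inr (conj_eq_inv_of_mul_self_eq_one hy h))
      · exact .inr (Set.mem_smul_set_iff_inv_smul_mem.2 (by simpa using h))
    linarith [hone _ hI]
  · push Not at hx
    have hI : CosetCovered (squareMap ⁻¹' {(1 : G)}) (0 + 0) := by
      refine ((CosetCovered.of_not_finiteIndex 1 hF).union
        (CosetCovered.of_not_finiteIndex s hF)).mono fun y hy => ?_
      by_cases h : y ∈ fcCenter G
      · exact .inl (by simpa using h)
      · exact .inr ((mem_leftCoset_iff s).2 (hx y (mem_preimage_squareMap_one.1 hy) h))
    linarith [hone _ hI]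

theorem isVirtuallyAbelian_of_cover [Group.FG G] (s : G) {A : Set G} {α : ℝ}
    (hA : CosetCovered A α)
    (hcover : (Set.univ : Set G) = squareMap ⁻¹' {1} ∪ s • (squareMap ⁻¹' {1}) ∪ A)
    (hα : α < 1 / 3) : IsVirtuallyAbelian G :=
  isVirtuallyAbelian_of_fcCenter_finiteIndex (fcCenter_finiteIndex_of_cover s hA hcover hα)

end SquareRoots

theorem lemma4p5 {G : Type*} [Group G] [Group.FG G] (s : G) (m : ℕ)
    (H : Fin m → Subgroup G) (a : Fin m → G)
    (hcover : (Set.univ : Set G) =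
      squareMap ⁻¹' {1} ∪ s • (squareMap ⁻¹' {1}) ∪ ⋃ i, a i • (H i : Set G))
    (α : ℝ) (hα : α = sumInvIndex H) :
    (α < (3 - √5) / 4 →
      IsVirtuallyAbelian G ∨
        ((conjugatesOf (s ^ 2)).Finite ∧
          ((conjugatesOf (s ^ 2)).ncard : ℝ) < 4 / (3 - √5 - 4 * α) ^ 2)) ∧
    (s ^ 2 = 1 → α < (1 - α) ^ 3 / 24 → IsVirtuallyAbelian G) := by
  have hα0 : 0 ≤ α := by
    rw [hα]
    exact Finset.sum_nonneg fun i _ => inv_nonneg.2 (Nat.cast_nonneg _)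
  have key : α < 1 / 3 → IsVirtuallyAbelian G := fun h =>
    isVirtuallyAbelian_of_cover s
      ⟨Fin m, inferInstance, H, a, subset_rfl, hα.symm⟩ hcover h
  refine ⟨fun h => Or.inl (key ?_), fun _ h => key ?_⟩
  · have h2 : (2 : ℝ) < √5 := Real.lt_sqrt_of_sq_lt (by norm_num)
    linarith
  · by_contra! h3
    -- Positivity of the cube forces `0 < 1 - α ≤ 1`, so that the hypothesis gives `α < 1 / 24`.
    have h4 : 0 < (1 - α) ^ 3 := by linarith
    have h5 : 0 < 1 - α := (Odd.pow_pos_iff (by decide)).1 h4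
    have h6 : (1 - α) ^ 3 ≤ 1 := pow_le_one₀ h5.le (by linarith)
    linarith
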